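/- All forms have real coefficients. Let $m\ge 2$. An $m\times 2$ biquadratic form is $f(\hat x,\hat y)=\sum_{i,j=1}^m\sum_{k,l=1}^2 a_{ijkl}\,\hat x_i\hat x_j\hat y_k\hat y_l$. It is positive semidefinite (psd) if $f(\hat x,\hat y)\ge 0$ for all $\hat x\in\mathbb R^m,\hat y\in\mathbb R^2$, and positive definite (pd) if $f(\hat x,\hat y)>0$ whenever $\hat x\neq 0$ and $\hat y\ne 0$. A quartic form is sos if it is a finite sum of squares of quadratic forms; its sos rank is the least number of squares in such an expression ($\infty$ if there is none). An $(m-1)\times1\times1$ tripartite quartic form is a quartic form $h(x,y,z)$, $x\in\mathbb R^{m-1}$, $y,z\in\mathbb R$, each of whose terms has total degree at most $2$ in the variables $x_1,\dots,x_{m-1}$ and degree at most $2$ in $y$. It is called degenerated if it is psd (nonnegative everywhere) and the coefficient of $z^4$ in $h$ is $0$. A biquadratic form $f$ corresponds to a quartic form $p(x,y,z)$ if there are $c>0$ and invertible matrices $A\in\mathbb R^{m\times m}$, $B\in\mathbb R^{2\times 2}$ such that $$p(x,y,z)=c\,f\big(A(x_1,\dots,x_{m-1},z)^\top,\;B(y,z)^\top\big),$$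 that is, $p$ arises from $c\,f(A\hat x,B\hat y)$ by setting $\hat x_m=\hat y_2=1$ and homogenizing to degree four with $z$. **Theorem.** For every $m\times 2$ positive definite biquadratic form $f$ there is an $(m-1)\times1\times1$ degenerated tripartite quartic form $h$ such that $h$ is sos, $f$ corresponds to $h+z^4$, the forms $f$ and $h+z^4$ have the same sos rank, and $$\operatorname{sosrank}(f)\le \operatorname{sosrank}(h)+1 .$$ Consequently, the sos rank problem for $m\times2$ forms reduces to degenerated tripartite quartic forms: if $r\in\mathbb N$ is such that every $(m-1)\times1\times1$ degenerated tripartite quartic form has sos rank at most $r$, then every $m\times 2$ psd biquadratic form has sos rank at most $r+1$. -/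

import Mathlib

open MvPolynomial

namespace Biquad

noncomputable section

/-- Real polynomials in the two groups of variables `x₁, …, x_m` and `y₁, …, y_n`. -/
abbrev BiPoly (m n : ℕ) := MvPolynomial (Fin m ⊕ Fin n) ℝ

/-- Real polynomials in `x₁, …, x_k`, `y₁, …, y_l` and one complementary variable `z`. -/
abbrev TriPoly (k l : ℕ) := MvPolynomial (Fin k ⊕ Fin l ⊕ Unit) ℝ

/-- `f` is an `m × n` biquadratic form `∑ a_{ijkl} x_i x_j y_k y_l`. -/
def IsBiquadratic {m n : ℕ} (f : BiPoly m n) : Prop :=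
  ∃ a : Fin m → Fin m → Fin n → Fin n → ℝ,
    f = ∑ i, ∑ j, ∑ k, ∑ l, C (a i j k l) *
      (X (Sum.inl i) * X (Sum.inl j) * X (Sum.inr k) * X (Sum.inr l))

/-- Positive semidefinite: nonnegative at every real point. -/
def IsPSD {σ : Type} (p : MvPolynomial σ ℝ) : Prop :=
  ∀ v : σ → ℝ, 0 ≤ eval v p

/-- A form in `(x, y)` is positive definite (in the biquadratic sense) if `f(x, y) > 0` for all
nonzero `x` and nonzero `y`. -/
def IsPD {m n : ℕ} (f : BiPoly m n) : Prop :=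
  ∀ (x : Fin m → ℝ) (y : Fin n → ℝ), x ≠ 0 → y ≠ 0 → 0 < eval (Sum.elim x y) f

/-- The quartic `p` is a sum of `r` squares of quadratic forms. -/
def IsSumOfSquares {σ : Type} (p : MvPolynomial σ ℝ) (r : ℕ) : Prop :=
  ∃ q : Fin r → MvPolynomial σ ℝ, (∀ i, (q i).IsHomogeneous 2) ∧ p = ∑ i, q i ^ 2

/-- The quartic `p` is sos. -/
def IsSOS {σ : Type} (p : MvPolynomial σ ℝ) : Prop :=
  ∃ r : ℕ, IsSumOfSquares p r

/-- The sos rank: the least number of squares in an sos expression (`⊤` if there is none). -/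
def sosRank {σ : Type} (p : MvPolynomial σ ℝ) : ℕ∞ :=
  ⨅ (r : ℕ) (_ : IsSumOfSquares p r), (r : ℕ∞)

/-- The complementary variable `z`. -/
def Z {k l : ℕ} : TriPoly k l := X (Sum.inr (Sum.inr ()))

/-- `h` is a `k × l × 1` tripartite quartic form: a quartic form each of whose terms has total
degree at most two in the `x`-variables and total degree at most two in the `y`-variables. -/
def IsTripartite {k l : ℕ} (h : TriPoly k l) : Prop :=
  h.IsHomogeneous 4 ∧ ∀ d ∈ h.support,
    ∑ i, d (Sum.inl i) ≤ 2 ∧ ∑ j, d (Sum.inr (Sum.inl j)) ≤ 2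

/-- A degenerated tripartite quartic form: a psd tripartite quartic form in which the coefficient
`h₀` of `z⁴` vanishes. -/
def IsDegenerated {k l : ℕ} (h : TriPoly k l) : Prop :=
  IsTripartite h ∧ coeff (Finsupp.single (Sum.inr (Sum.inr ())) 4) h = 0 ∧ IsPSD h

/-- The polynomial `f(A x, B y)`. -/
def linearChange {m n : ℕ} (A : Matrix (Fin m) (Fin m) ℝ) (B : Matrix (Fin n) (Fin n) ℝ)
    (f : BiPoly m n) : BiPoly m n :=
  aeval (Sum.elim (fun i => ∑ j, C (A i j) * X (Sum.inl j))
    (fun i => ∑ j, C (B i j) * X (Sum.inr j))) f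

/-- Dehomogenization `x_m = 1`, `y_n = 1` followed by homogenization to degree four with `z`.
On a biquadratic form this is the substitution `x_m = z`, `y_n = z`: the exponent of `z` in the
image of a term `x_i x_j y_k y_l` is the number of factors equal to `x_m` or `y_n`, i.e. four minus
the degree of the dehomogenized term. -/
def toTripartite {m n : ℕ} (f : BiPoly m n) : TriPoly (m - 1) (n - 1) :=
  aeval (Sum.elim
    (fun i : Fin m => if hi : i.val < m - 1 then X (Sum.inl ⟨i.val, hi⟩) else Z)
    (fun j : Fin n => if hj : j.val < n - 1 then X (Sum.inr (Sum.inl ⟨j.val, hj⟩)) else Z)) f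

/-- `f` corresponds to `p`: after a positive scaling and invertible linear changes of `x` and of
`y`, dehomogenizing and homogenizing `f` gives `p`. -/
def CorrespondsTo {m n : ℕ} (f : BiPoly m n) (p : TriPoly (m - 1) (n - 1)) : Prop :=
  ∃ (c : ℝ) (A : Matrix (Fin m) (Fin m) ℝ) (B : Matrix (Fin n) (Fin n) ℝ),
    0 < c ∧ IsUnit A.det ∧ IsUnit B.det ∧ p = toTripartite (C c * linearChange A B f)

end

end Biquad

/-! Let `μ` be the minimum of `f` over the product of the two unit spheres. Orthogonal changes of
variables move a minimizer to the last coordinate vectors, and bihomogeneity gives `f ≥ μ |x|² |y|²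
≥ μ x_m² y_2²` (`exists_linearChange_le`). If `μ > 0`, then `g = μ⁻¹ f - x_m² y_2²` is a psd
biquadratic form with a zero at those vectors. Dehomogenizing turns `g` into a degenerated `h`, and
`x_m² y_2²` into `z⁴ = (z²)²`, which costs one square. If `μ = 0`, the form `f` itself dehomogenizes
to a degenerated form.

Two facts carry the rest. Dehomogenization neither creates nor destroys representations by `r`
squares (`isSumOfSquares_toTripartite_iff`), so ranks are preserved. And psd `m × 2` forms are sos,
which makes `h` sos. The latter is proved by duality for pencils `s² A + 2 s t B + t² C`: a triple
outside the closed convex cone of pencils with a psd Gram matrix is separated from it by a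
functional given by a psd moment matrix with symmetric off-diagonal block. Simultaneous
diagonalization writes such a matrix, after a small perturbation, as a nonnegative combination of
point evaluations, and these are nonnegative on a psd pencil. -/

namespace Matrix

/-! ### The cone of quadratic matrix pencils with a psd Gram matrix -/

variable {n : Type*}

/-- The Gram matrices `[[A, D], [Dᵀ, C]]` of the pencil `s² A + 2 s t B + t² C`. -/
def HasGram (A B C : Matrix n n ℝ) : Prop :=
  ∃ D : Matrix n n ℝ, (fromBlocks A D Dᵀ C).PosSemidef ∧ D + Dᵀ = (2 : ℝ) • B

theorem convex_setOf_hasGram :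
    Convex ℝ {p : Matrix n n ℝ × Matrix n n ℝ × Matrix n n ℝ | HasGram p.1 p.2.1 p.2.2} := by
  rintro p ⟨D, hD, hB⟩ q ⟨D', hD', hB'⟩ a b ha hb -
  refine ⟨a • D + b • D', ?_, ?_⟩
  · have := (hD.smul ha).add (hD'.smul hb)
    rw [fromBlocks_smul, fromBlocks_smul, fromBlocks_add] at this
    simpa using this
  · have : a • (D + Dᵀ) + b • (D' + D'ᵀ) = (2 : ℝ) • (a • p.2.1 + b • q.2.1) := by
      rw [hB, hB', smul_add, smul_comm a, smul_comm b]
    rw [Prod.snd_add, Prod.fst_add, Prod.smul_snd, Prod.smul_fst, Prod.smul_snd, Prod.smul_fst,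
      ← this]
    simp only [transpose_add, transpose_smul, smul_add]
    abel

theorem HasGram.smul {A B C : Matrix n n ℝ} (h : HasGram A B C) {a : ℝ} (ha : 0 ≤ a) :
    HasGram (a • A) (a • B) (a • C) := by
  obtain ⟨D, hD, hB⟩ := h
  refine ⟨a • D, ?_, ?_⟩
  · simpa [fromBlocks_smul] using hD.smul ha
  · rw [transpose_smul, ← smul_add, hB, smul_comm]

variable [Fintype n]

/-- This is the pencil of the single square `(s a·x + t b·x)²`. A functional nonnegative on all of
these has a psd moment matrix. -/
theorem hasGram_vecMulVec (a b : n → ℝ) :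
    HasGram (vecMulVec a a) ((1 / 2 : ℝ) • (vecMulVec a b + vecMulVec b a)) (vecMulVec b b) := by
  refine ⟨vecMulVec a b, ?_, ?_⟩
  · have := posSemidef_vecMulVec_self_star (Sum.elim a b)
    convert this using 1
    ext i j
    rcases i with i | i <;> rcases j with j | j <;> simp [vecMulVec_apply, mul_comm]
  · simp [smul_smul]

theorem trace_mul_vecMulVec (A : Matrix n n ℝ) (v w : n → ℝ) :
    (A * vecMulVec v w).trace = w ⬝ᵥ (A *ᵥ v) := by
  rw [mul_vecMulVec, trace_vecMulVec, dotProduct_comm]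

theorem trace_mul_nonneg_of_forall {A P : Matrix n n ℝ} (hA : ∀ x, 0 ≤ x ⬝ᵥ (A *ᵥ x))
    (hP : P.PosSemidef) : 0 ≤ (A * P).trace := by
  obtain ⟨k, v, rfl⟩ := posSemidef_iff_eq_sum_vecMulVec.mp hP
  rw [Matrix.mul_sum, trace_sum]
  exact Finset.sum_nonneg fun i _ => by simpa [trace_mul_vecMulVec] using hA (v i)

theorem PosSemidef.sq_apply_le {M : Matrix n n ℝ}
    (hM : M.PosSemidef) (i j : n) : M i j ^ 2 ≤ M i i * M j j := by
  obtain ⟨k, v, rfl⟩ := posSemidef_iff_eq_sum_vecMulVec.mp hM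
  simp only [sum_apply, vecMulVec_apply, star_trivial]
  simpa [sq] using Finset.sum_mul_sq_le_sq_mul_sq Finset.univ (fun l => v l i) (fun l => v l j)

theorem isClosed_setOf_posSemidef :
    IsClosed {M : Matrix n n ℝ | M.PosSemidef} := by
  have : {M : Matrix n n ℝ | M.PosSemidef} =
      {M | Mᴴ = M} ∩ ⋂ x : n → ℝ, {M | 0 ≤ x ⬝ᵥ (M *ᵥ x)} := by
    ext M
    simp [posSemidef_iff_dotProduct_mulVec, IsHermitian]
  rw [this]
  refine (isClosed_eq (by fun_prop) (by fun_prop)).inter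
    (isClosed_iInter fun x => isClosed_le continuous_const (by fun_prop))

/-- Along a convergent sequence of pencils the diagonal blocks stay bounded, and the 2 × 2 minors
give `D i j ^ 2 ≤ A i i * C j j`. So the off-diagonal blocks lie in a compact ball, and a
subsequential limit is a Gram block for the limit pencil. -/
theorem isClosed_setOf_hasGram :
    IsClosed {p : Matrix n n ℝ × Matrix n n ℝ × Matrix n n ℝ | HasGram p.1 p.2.1 p.2.2} := by
  -- Passing to plain functions gives access to the sup norm, used for the bound and the compact
  -- ball.
  suffices h : IsClosed {p : (n → n → ℝ) × (n → n → ℝ) × (n → n → ℝ) |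
      HasGram (of p.1) (of p.2.1) (of p.2.2)} from h
  refine IsSeqClosed.isClosed fun p q hp hq => ?_
  choose D₀ hD₀ hDB₀ using hp
  have hex : ∃ D : ℕ → n → n → ℝ,
      (∀ k, (fromBlocks (of (p k).1) (of (D k)) (of (D k))ᵀ (of (p k).2.2)).PosSemidef) ∧
      ∀ k, of (D k) + (of (D k))ᵀ = (2 : ℝ) • of (p k).2.1 := ⟨D₀, hD₀, hDB₀⟩
  obtain ⟨D, hD, hDB⟩ := hex
  have hbdd : ∃ K, ∀ k, ‖p k‖ ≤ K := by
    obtain ⟨K, hK⟩ := (Metric.isBounded_range_of_tendsto p hq).exists_norm_le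
    exact ⟨K, fun k => hK _ ⟨k, rfl⟩⟩
  obtain ⟨K, hK⟩ := hbdd
  have hK0 : 0 ≤ K := (norm_nonneg _).trans (hK 0)
  have hDK : ∀ k, D k ∈ Metric.closedBall (0 : n → n → ℝ) K := by
    intro k
    rw [mem_closedBall_zero_iff, pi_norm_le_iff_of_nonneg hK0]
    refine fun i => (pi_norm_le_iff_of_nonneg hK0).mpr fun j => ?_
    have h1 := (hD k).sq_apply_le (Sum.inl i) (Sum.inr j)
    simp only [fromBlocks_apply₁₁, fromBlocks_apply₁₂, fromBlocks_apply₂₂, of_apply] at h1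
    have hA : |(p k).1 i i| ≤ K :=
      ((norm_le_pi_norm ((p k).1 i) i).trans (norm_le_pi_norm (p k).1 i)).trans
      ((norm_fst_le _).trans (hK k))
    have hC : |(p k).2.2 j j| ≤ K :=
      ((norm_le_pi_norm ((p k).2.2 j) j).trans (norm_le_pi_norm (p k).2.2 j)).trans
      ((norm_snd_le _).trans ((norm_snd_le _).trans (hK k)))
    rw [Real.norm_eq_abs]
    refine abs_le_of_sq_le_sq (h1.trans ?_) hK0
    calc (p k).1 i i * (p k).2.2 j j ≤ |(p k).1 i i| * |(p k).2.2 j j| := by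
          rw [← abs_mul]; exact le_abs_self _
      _ ≤ K ^ 2 := by rw [sq]; gcongr
  obtain ⟨D', -, φ, hφ, hlim⟩ := (isCompact_closedBall (0 : n → n → ℝ) K).tendsto_subseq hDK
  have hq' := hq.comp hφ.tendsto_atTop
  have hA : Filter.Tendsto (fun k => (p (φ k)).1) .atTop (nhds q.1) :=
    (continuous_fst.tendsto _).comp hq'
  have hB : Filter.Tendsto (fun k => (p (φ k)).2.1) .atTop (nhds q.2.1) :=
    ((continuous_fst.comp continuous_snd).tendsto _).comp hq'
  have hC : Filter.Tendsto (fun k => (p (φ k)).2.2) .atTop (nhds q.2.2) :=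
    ((continuous_snd.comp continuous_snd).tendsto _).comp hq'
  have hgram : Filter.Tendsto
      (fun k => fromBlocks (of (p (φ k)).1) (of (D (φ k))) (of (D (φ k)))ᵀ (of (p (φ k)).2.2)) .atTop
      (nhds (fromBlocks (of q.1) (of D') (of D')ᵀ (of q.2.2))) := by
    have hcont : Continuous fun x : (n → n → ℝ) × (n → n → ℝ) × (n → n → ℝ) =>
        fromBlocks (of x.1) (of x.2.1) (of x.2.1)ᵀ (of x.2.2) :=
      Continuous.matrix_fromBlocks continuous_fst (continuous_fst.comp continuous_snd)
        (continuous_fst.comp continuous_snd).matrix_transpose (continuous_snd.comp continuous_snd)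
    exact (hcont.tendsto (q.1, D', q.2.2)).comp (hA.prodMk_nhds (hlim.prodMk_nhds hC))
  refine ⟨of D', isClosed_setOf_posSemidef.mem_of_tendsto hgram (.of_forall fun k => hD (φ k)), ?_⟩
  ext i j
  have hent : ∀ {f : ℕ → n → n → ℝ} {g : n → n → ℝ}, Filter.Tendsto f .atTop (nhds g) → ∀ i j,
      Filter.Tendsto (fun k => f k i j) .atTop (nhds (g i j)) := fun h i j =>
    tendsto_pi_nhds.mp (tendsto_pi_nhds.mp h i) j
  refine tendsto_nhds_unique ((hent hlim i j).add (hent hlim j i))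
    (((hent hB i j).const_mul 2).congr fun k => ?_)
  simpa using (congrFun₂ (hDB (φ k)) i j).symm

/-! ### Moment matrices, the dual cone and separation -/

variable [DecidableEq n]

open scoped MatrixOrder in
-- Factor `R = Sᵀ S` and diagonalize the symmetric matrix `S⁻¹ᵀ Q S⁻¹ = U d Uᵀ`; then `W = Sᵀ U`
-- works because `U` is orthogonal.
theorem PosDef.exists_simultaneous_diagonalization {R Q : Matrix n n ℝ} (hR : R.PosDef)
    (hQ : Q.IsHermitian) :
    ∃ (W : Matrix n n ℝ) (d : n → ℝ),
      IsUnit W.det ∧ R = W * Wᵀ ∧ Q = W * diagonal d * Wᵀ := by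
  obtain ⟨S, hS⟩ := CStarAlgebra.nonneg_iff_eq_star_mul_self.mp hR.posSemidef.nonneg
  have hS' : R = Sᵀ * S := by simpa [star_eq_conjTranspose] using hS
  have hdet : IsUnit S.det := by
    have h := hR.det_pos
    rw [hS', det_mul, det_transpose] at h
    exact isUnit_iff_ne_zero.mpr fun h0 => by simp [h0] at h
  have hT : (S⁻¹ᵀ * Q * S⁻¹).IsHermitian := by
    simpa using isHermitian_conjTranspose_mul_mul S⁻¹ hQ
  have hU := hT.eigenvectorUnitary.2
  set U : Matrix n n ℝ := hT.eigenvectorUnitary.1 with hUdef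
  have hUU : U * Uᵀ = 1 := by
    have := Unitary.mul_star_self_of_mem hU
    simpa [star_eq_conjTranspose] using this
  have hspec : S⁻¹ᵀ * Q * S⁻¹ = U * diagonal hT.eigenvalues * Uᵀ := by
    conv_lhs => rw [hT.spectral_theorem]
    simp [Unitary.conjStarAlgAut_apply, star_eq_conjTranspose, hUdef]
  refine ⟨Sᵀ * U, hT.eigenvalues, ?_, ?_, ?_⟩
  · rw [det_mul, det_transpose]
    refine hdet.mul (isUnit_iff_ne_zero.mpr fun h0 => ?_)
    have := congrArg det hUU
    simp [h0] at this
  · rw [transpose_mul, transpose_transpose, Matrix.mul_assoc, ← Matrix.mul_assoc U, hUU,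
      Matrix.one_mul, hS']
  · have h1 : Sᵀ * U * diagonal hT.eigenvalues * (Sᵀ * U)ᵀ
        = Sᵀ * (U * diagonal hT.eigenvalues * Uᵀ) * S := by
      simp only [transpose_mul, transpose_transpose, Matrix.mul_assoc]
    have h2 : Sᵀ * S⁻¹ᵀ = 1 := by
      rw [← transpose_mul, nonsing_inv_mul _ hdet, transpose_one]
    rw [h1, ← hspec]
    calc Q = (Sᵀ * S⁻¹ᵀ) * Q * (S⁻¹ * S) := by
          rw [h2, nonsing_inv_mul _ hdet, Matrix.one_mul, Matrix.mul_one]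
      _ = _ := by simp only [Matrix.mul_assoc]

theorem trace_mul_diagonal_conj (A W : Matrix n n ℝ) (d : n → ℝ) :
    (A * (W * diagonal d * Wᵀ)).trace = ∑ i, d i * (Wᵀ i ⬝ᵥ (A *ᵥ Wᵀ i)) := by
  have h : (A * (W * diagonal d * Wᵀ)).trace = ((Wᵀ * A * W) * diagonal d).trace := by
    rw [trace_mul_comm, ← trace_mul_comm (diagonal d), Matrix.mul_assoc, Matrix.mul_assoc,
      trace_mul_comm, Matrix.mul_assoc, Matrix.mul_assoc]
  rw [h]
  simp only [trace, diag_apply, mul_diagonal]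
  refine Finset.sum_congr rfl fun i _ => ?_
  rw [mul_comm, Matrix.mul_assoc]
  rfl

/-- The moment matrices of bilinear forms with symmetric off-diagonal block are nonnegative
combinations of point evaluations. -/
theorem trace_pencil_nonneg_of_posDef {A B C P Q R : Matrix n n ℝ}
    (h : ∀ (s t : ℝ) (x : n → ℝ),
      0 ≤ s ^ 2 * (x ⬝ᵥ (A *ᵥ x)) + 2 * (s * t) * (x ⬝ᵥ (B *ᵥ x)) + t ^ 2 * (x ⬝ᵥ (C *ᵥ x)))
    (hM : (fromBlocks P Q Q R).PosSemidef) (hQ : Q.IsHermitian) (hR : R.PosDef) :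
    0 ≤ (A * P).trace + 2 * (B * Q).trace + (C * R).trace := by
  obtain ⟨W, d, hW, hRW, hQW⟩ := hR.exists_simultaneous_diagonalization hQ
  let : Invertible R := hR.isUnit.invertible
  have hS : (P - Q * R⁻¹ * Q).PosSemidef := by
    have := (PosDef.fromBlocks₂₂ P Q hR).mp (by rwa [hQ.eq])
    rwa [hQ.eq] at this
  have hWt : IsUnit Wᵀ.det := by rwa [det_transpose]
  have hQRQ : Q * R⁻¹ * Q = W * diagonal (fun i => d i ^ 2) * Wᵀ := by
    have h1 : R⁻¹ = Wᵀ⁻¹ * W⁻¹ := by rw [hRW, mul_inv_rev]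
    calc Q * R⁻¹ * Q
        = W * diagonal d * (Wᵀ * Wᵀ⁻¹) * (W⁻¹ * W) * diagonal d * Wᵀ := by
          rw [h1, hQW]; simp only [Matrix.mul_assoc]
      _ = W * (diagonal d * diagonal d) * Wᵀ := by
          rw [mul_nonsing_inv _ hWt, nonsing_inv_mul _ hW]
          simp only [Matrix.mul_one, Matrix.mul_assoc]
      _ = _ := by
          rw [diagonal_mul_diagonal]
          simp only [sq]
  -- With `w i` the columns of `W`, the moment matrix splits into the psd Schur complement, paired
  -- with `A` alone (the point `(s, t) = (1, 0)`), plus the evaluations at `(s, t) = (d i, 1)`, `x =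
  -- w i`.
  have hP : (A * P).trace = (A * (P - Q * R⁻¹ * Q)).trace
      + ∑ i, d i ^ 2 * (Wᵀ i ⬝ᵥ (A *ᵥ Wᵀ i)) := by
    rw [← trace_mul_diagonal_conj, ← hQRQ, ← trace_add, ← Matrix.mul_add, sub_add_cancel]
  have hR' : (C * R).trace = ∑ i, 1 * (Wᵀ i ⬝ᵥ (C *ᵥ Wᵀ i)) := by
    rw [← trace_mul_diagonal_conj, hRW]
    simp
  have hQ' : (B * Q).trace = ∑ i, d i * (Wᵀ i ⬝ᵥ (B *ᵥ Wᵀ i)) := by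
    rw [← trace_mul_diagonal_conj, ← hQW]
  have h0 := trace_mul_nonneg_of_forall (fun x => by simpa using h 1 0 x) hS
  have h1 : 0 ≤ ∑ i, (d i ^ 2 * (Wᵀ i ⬝ᵥ (A *ᵥ Wᵀ i))
      + 2 * (d i * (Wᵀ i ⬝ᵥ (B *ᵥ Wᵀ i))) + 1 * (Wᵀ i ⬝ᵥ (C *ᵥ Wᵀ i))) :=
    Finset.sum_nonneg fun i _ => by
      have := h (d i) 1 (Wᵀ i)
      linarith
  rw [Finset.sum_add_distrib, Finset.sum_add_distrib, ← Finset.mul_sum] at h1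
  linarith

/-- Replacing `R` by `R + ε • 1` makes it positive definite and changes the pairing only by `ε *
C.trace`. -/
theorem trace_pencil_nonneg {A B C P Q R : Matrix n n ℝ}
    (h : ∀ (s t : ℝ) (x : n → ℝ),
      0 ≤ s ^ 2 * (x ⬝ᵥ (A *ᵥ x)) + 2 * (s * t) * (x ⬝ᵥ (B *ᵥ x)) + t ^ 2 * (x ⬝ᵥ (C *ᵥ x)))
    (hM : (fromBlocks P Q Q R).PosSemidef) (hQ : Q.IsHermitian) :
    0 ≤ (A * P).trace + 2 * (B * Q).trace + (C * R).trace := by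
  have hR : R.PosSemidef := by
    have hsub : (fromBlocks P Q Q R).submatrix Sum.inr Sum.inr = R := rfl
    exact hsub ▸ hM.submatrix Sum.inr
  have hC : 0 ≤ C.trace := by
    simpa using trace_mul_nonneg_of_forall (P := 1) (fun x => by simpa using h 0 1 x)
      PosSemidef.one
  have key : ∀ ε : ℝ, 0 < ε →
      0 ≤ (A * P).trace + 2 * (B * Q).trace + (C * R).trace + ε * C.trace := by
    intro ε hε
    have h1 : (fromBlocks P Q Q (R + ε • 1)).PosSemidef := by
      have h2 : (fromBlocks (0 : Matrix n n ℝ) 0 0 (ε • (1 : Matrix n n ℝ))).PosSemidef := by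
        have := (PosSemidef.diagonal (n := n ⊕ n) (d := Sum.elim (0 : n → ℝ) (fun _ => ε))
          (fun i => by cases i <;> simp [hε.le]))
        rw [← fromBlocks_diagonal] at this
        convert this using 2
        · simp
        · ext i j; simp [diagonal, one_apply]
      simpa [fromBlocks_add] using hM.add h2
    have := trace_pencil_nonneg_of_posDef h h1 hQ (PosDef.posSemidef_add hR (PosDef.one.smul hε))
    simpa [Matrix.mul_add, trace_add, add_assoc] using this
  by_contra! hneg
  -- For this `ε` the perturbation is at most half the absolute value of the negative pairing, so
  -- the sum remains negative.
  have := key (-((A * P).trace + 2 * (B * Q).trace + (C * R).trace) / (2 * (C.trace + 1)))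
    (by apply div_pos <;> linarith)
  rw [div_mul_eq_mul_div, ← sub_le_iff_le_add', div_eq_mul_inv] at this
  have h3 : C.trace * (2 * (C.trace + 1))⁻¹ ≤ 1 / 2 := by
    rw [← div_eq_mul_inv, div_le_iff₀ (by linarith)]; linarith
  nlinarith

/-- Symmetrizing a representing matrix does not change its trace pairing with symmetric matrices.
This is the source of the symmetric off-diagonal block of the moment matrix. -/
theorem exists_trace_representation (φ : Matrix n n ℝ →ₗ[ℝ] ℝ) :
    ∃ P : Matrix n n ℝ, P.IsHermitian ∧ ∀ A : Matrix n n ℝ, A.IsHermitian →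
      φ A = (A * P).trace := by
  let P₀ : Matrix n n ℝ := of fun i j => φ (single j i 1)
  have h0 : ∀ A, φ A = (A * P₀).trace := by
    intro A
    conv_lhs => rw [matrix_eq_sum_single A]
    simp only [map_sum, trace, diag_apply, mul_apply]
    refine Finset.sum_congr rfl fun i _ => Finset.sum_congr rfl fun j _ => ?_
    have : single i j (A i j) = A i j • single i j (1 : ℝ) := by simp [smul_single]
    rw [this, map_smul, smul_eq_mul]
    rfl
  refine ⟨(1 / 2 : ℝ) • (P₀ + P₀ᵀ), ?_, fun A hA => ?_⟩
  · rw [IsHermitian, conjTranspose_eq_transpose_of_trivial, transpose_smul, transpose_add,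
      transpose_transpose, add_comm]
  · have hA' : Aᵀ = A := by simpa using hA.eq
    have : (A * P₀ᵀ).trace = (A * P₀).trace := by
      rw [← trace_transpose, transpose_mul, transpose_transpose, hA', trace_mul_comm]
    rw [Matrix.mul_smul, trace_smul, Matrix.mul_add, trace_add, this, h0 A, smul_eq_mul]
    ring

/-- A positive semidefinite quadratic matrix pencil is a sum of squares. -/
theorem hasGram_of_forall_nonneg {A B C : Matrix n n ℝ} (hA : A.IsHermitian) (hB : B.IsHermitian)
    (hC : C.IsHermitian)
    (h : ∀ (s t : ℝ) (x : n → ℝ),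
      0 ≤ s ^ 2 * (x ⬝ᵥ (A *ᵥ x)) + 2 * (s * t) * (x ⬝ᵥ (B *ᵥ x)) + t ^ 2 * (x ⬝ᵥ (C *ᵥ x))) :
    HasGram A B C := by
  have : LocallyConvexSpace ℝ (Matrix n n ℝ) := inferInstanceAs (LocallyConvexSpace ℝ (n → n → ℝ))
  by_contra hnot
  obtain ⟨l, u, hlu, hl⟩ := geometric_hahn_banach_point_closed (x := (A, B, C))
    convex_setOf_hasGram isClosed_setOf_hasGram hnot
  have hu : u < 0 := by
    have := hl 0 ⟨0, by simpa using PosSemidef.zero, by simp⟩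
    simpa using this
  have hpos : ∀ p : Matrix n n ℝ × Matrix n n ℝ × Matrix n n ℝ, HasGram p.1 p.2.1 p.2.2 →
      0 ≤ l p := by
    intro p hp
    by_contra! hneg
    -- A cone point with negative value could be scaled until its value is exactly `u`,
    -- contradicting strict separation.
    have := hl ((u / l p) • p) (hp.smul (div_pos_of_neg_of_neg hu hneg).le)
    rw [map_smul, smul_eq_mul, div_mul_cancel₀ _ hneg.ne] at this
    exact lt_irrefl _ this
  have hsplit : ∀ X Y Z : Matrix n n ℝ, l (X, Y, Z) = l (X, 0, 0) + l (0, Y, 0) + l (0, 0, Z) := by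
    intro X Y Z
    rw [← map_add, ← map_add]
    simp
  obtain ⟨P, hP, hlP⟩ := exists_trace_representation
    (l.toLinearMap ∘ₗ LinearMap.inl ℝ _ _)
  obtain ⟨Q, hQ, hlQ⟩ := exists_trace_representation
    (l.toLinearMap ∘ₗ LinearMap.inr ℝ _ _ ∘ₗ LinearMap.inl ℝ _ _)
  obtain ⟨R, hR, hlR⟩ := exists_trace_representation
    (l.toLinearMap ∘ₗ LinearMap.inr ℝ _ _ ∘ₗ LinearMap.inr ℝ _ _)
  have hrep : ∀ X Y Z : Matrix n n ℝ, X.IsHermitian → Y.IsHermitian → Z.IsHermitian →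
      l (X, Y, Z) = (X * P).trace + (Y * Q).trace + (Z * R).trace := by
    intro X Y Z hX hY hZ
    rw [hsplit, ← hlP X hX, ← hlQ Y hY, ← hlR Z hZ]
    rfl
  have hQ2 : ((1 / 2 : ℝ) • Q).IsHermitian := by
    rw [IsHermitian, conjTranspose_smul, hQ.eq, star_trivial]
  have hM : (fromBlocks P ((1 / 2 : ℝ) • Q) ((1 / 2 : ℝ) • Q) R).PosSemidef := by
    refine PosSemidef.of_dotProduct_mulVec_nonneg ?_ fun v => ?_
    · exact IsHermitian.fromBlocks hP hQ2.eq hR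
    · obtain ⟨a, b, rfl⟩ : ∃ a b, v = Sum.elim a b :=
        ⟨v ∘ Sum.inl, v ∘ Sum.inr, (Sum.elim_comp_inl_inr v).symm⟩
      have h1 : 0 ≤ l (vecMulVec a a, (1 / 2 : ℝ) • (vecMulVec a b + vecMulVec b a),
          vecMulVec b b) := hpos (_, _, _) (hasGram_vecMulVec a b)
      have hsymm : ∀ w : n → ℝ, (vecMulVec w w).IsHermitian := fun w => by
        ext i j; simp [vecMulVec_apply, mul_comm]
      rw [hrep _ _ _ (hsymm a) (by ext i j; simp [vecMulVec_apply]; ring) (hsymm b)] at h1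
      rw [trace_mul_comm, trace_mul_vecMulVec, smul_mul, trace_smul, trace_mul_comm, Matrix.mul_add,
        trace_add, trace_mul_vecMulVec, trace_mul_vecMulVec, trace_mul_comm,
        trace_mul_vecMulVec] at h1
      simp only [star_trivial, fromBlocks_mulVec, Sum.elim_comp_inl, Sum.elim_comp_inr,
        sumElim_dotProduct_sumElim, dotProduct_add, smul_mulVec, dotProduct_smul, smul_eq_mul] at h1 ⊢
      linarith
  have hfin := trace_pencil_nonneg h hM hQ2
  have hlt := hlu.trans hu
  rw [hrep A B C hA hB hC] at hlt
  rw [Matrix.mul_smul, trace_smul, smul_eq_mul] at hfin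
  linarith

end Matrix

namespace Biquad

open scoped Matrix

variable {m n r : ℕ} {σ τ : Type}

theorem eval_aeval_eq (v : τ → ℝ) (g : σ → MvPolynomial τ ℝ) (p : MvPolynomial σ ℝ) :
    eval v (aeval g p) = eval (fun i => eval v (g i)) p := by
  induction p using MvPolynomial.induction_on with
  | C a => simp
  | add p q hp hq => rw [map_add, map_add, map_add, hp, hq]
  | mul_X p i hp => rw [map_mul, map_mul, map_mul, hp, aeval_X, eval_X]

/-! ### Sums of squares and their ranks -/

theorem IsSumOfSquares.aeval {p : MvPolynomial σ ℝ} (hp : IsSumOfSquares p r)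
    {g : σ → MvPolynomial τ ℝ} (hg : ∀ i, (g i).IsHomogeneous 1) :
    IsSumOfSquares (MvPolynomial.aeval g p) r := by
  obtain ⟨q, hq, rfl⟩ := hp
  exact ⟨fun i => MvPolynomial.aeval g (q i), fun i => by simpa using (hq i).aeval g hg, by simp⟩

theorem IsSumOfSquares.C_mul {p : MvPolynomial σ ℝ} (hp : IsSumOfSquares p r) {c : ℝ}
    (hc : 0 ≤ c) : IsSumOfSquares (C c * p) r := by
  obtain ⟨q, hq, rfl⟩ := hp
  refine ⟨fun i => C √c * q i, fun i => (hq i).C_mul _, ?_⟩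
  simp only [mul_pow, ← C_pow, Real.sq_sqrt hc, Finset.mul_sum]

theorem IsSumOfSquares.add_sq {p q : MvPolynomial σ ℝ} (hp : IsSumOfSquares p r)
    (hq : q.IsHomogeneous 2) : IsSumOfSquares (p + q ^ 2) (r + 1) := by
  obtain ⟨s, hs, rfl⟩ := hp
  refine ⟨Fin.cons q s, Fin.cases hq hs, ?_⟩
  simp [Fin.sum_univ_succ, add_comm]

theorem sosRank_le_coe_iff {p : MvPolynomial σ ℝ} :
    sosRank p ≤ r ↔ ∃ s ≤ r, IsSumOfSquares p s := by
  constructor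
  · intro h
    have h' : sosRank p < ((r + 1 : ℕ) : ℕ∞) := h.trans_lt (by exact_mod_cast r.lt_succ_self)
    simp only [sosRank, iInf_lt_iff] at h'
    obtain ⟨s, hs, hlt⟩ := h'
    exact ⟨s, Nat.lt_succ_iff.mp (by exact_mod_cast hlt), hs⟩
  · rintro ⟨s, hs, hp⟩
    exact (iInf₂_le s hp).trans (by exact_mod_cast hs)

theorem sosRank_congr {p : MvPolynomial σ ℝ} {q : MvPolynomial τ ℝ}
    (h : ∀ r, IsSumOfSquares p r ↔ IsSumOfSquares q r) : sosRank p = sosRank q := by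
  simp only [sosRank, h]

theorem sosRank_add_sq_le (p : MvPolynomial σ ℝ) {q : MvPolynomial σ ℝ}
    (hq : q.IsHomogeneous 2) : sosRank (p + q ^ 2) ≤ sosRank p + 1 := by
  cases h : sosRank p with
  | top => simp
  | coe r =>
    obtain ⟨s, hs, hp⟩ := sosRank_le_coe_iff.mp h.le
    exact_mod_cast sosRank_le_coe_iff.mpr ⟨s + 1, by omega, hp.add_sq hq⟩

/-! ### Biquadratic forms -/

theorem IsBiquadratic.zero : IsBiquadratic (0 : BiPoly m n) := ⟨0, by simp⟩

theorem IsBiquadratic.add {f g : BiPoly m n} (hf : IsBiquadratic f) (hg : IsBiquadratic g) :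
    IsBiquadratic (f + g) := by
  obtain ⟨a, rfl⟩ := hf
  obtain ⟨b, rfl⟩ := hg
  exact ⟨a + b, by simp [add_mul, Finset.sum_add_distrib]⟩

theorem IsBiquadratic.C_mul {f : BiPoly m n} (hf : IsBiquadratic f) (c : ℝ) :
    IsBiquadratic (C c * f) := by
  obtain ⟨a, rfl⟩ := hf
  exact ⟨fun i j k l => c * a i j k l, by simp [Finset.mul_sum, mul_assoc]⟩

theorem IsBiquadratic.sub {f g : BiPoly m n} (hf : IsBiquadratic f) (hg : IsBiquadratic g) :
    IsBiquadratic (f - g) := by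
  simpa [sub_eq_add_neg] using hf.add (hg.C_mul (-1))

theorem IsBiquadratic.sum {ι : Type*} {s : Finset ι} {f : ι → BiPoly m n}
    (hf : ∀ i ∈ s, IsBiquadratic (f i)) : IsBiquadratic (∑ i ∈ s, f i) :=
  Finset.sum_induction _ _ (fun _ _ => .add) .zero hf

theorem isBiquadratic_X_mul (i j : Fin m) (k l : Fin n) :
    IsBiquadratic (X (Sum.inl i) * X (Sum.inl j) * X (Sum.inr k) * X (Sum.inr l) : BiPoly m n) := by
  refine ⟨fun i' j' k' l' => if i' = i ∧ j' = j ∧ k' = k ∧ l' = l then 1 else 0, ?_⟩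
  rw [Finset.sum_eq_single i, Finset.sum_eq_single j, Finset.sum_eq_single k,
    Finset.sum_eq_single l] <;> simp +contextual

theorem IsBiquadratic.linearChange {f : BiPoly m n} (hf : IsBiquadratic f)
    (A : Matrix (Fin m) (Fin m) ℝ) (B : Matrix (Fin n) (Fin n) ℝ) :
    IsBiquadratic (linearChange A B f) := by
  obtain ⟨a, rfl⟩ := hf
  simp only [Biquad.linearChange, map_sum, map_mul, aeval_X, Sum.elim_inl, Sum.elim_inr,
    algHom_C, algebraMap_eq]
  refine .sum fun i _ => .sum fun j _ => .sum fun k _ => .sum fun l _ => .C_mul ?_ _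
  simp only [Finset.sum_mul, Finset.mul_sum]
  refine .sum fun i' _ => .sum fun j' _ => .sum fun k' _ => .sum fun l' _ => ?_
  convert (isBiquadratic_X_mul l' k' j' i').C_mul (A i l' * A j k' * B k j' * B l i') using 1
  simp only [map_mul]
  ring

theorem eval_linearChange (A : Matrix (Fin m) (Fin m) ℝ) (B : Matrix (Fin n) (Fin n) ℝ)
    (f : BiPoly m n) (x : Fin m → ℝ) (y : Fin n → ℝ) :
    eval (Sum.elim x y) (linearChange A B f) = eval (Sum.elim (A *ᵥ x) (B *ᵥ y)) f := by
  rw [linearChange, eval_aeval_eq]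
  congr 2
  ext i
  cases i <;> simp [Matrix.mulVec, dotProduct]

theorem bipoly_funext {f g : BiPoly m n}
    (h : ∀ x y, eval (Sum.elim x y) f = eval (Sum.elim x y) g) : f = g :=
  MvPolynomial.funext fun v => by
    simpa [Sum.elim_comp_inl_inr] using h (v ∘ Sum.inl) (v ∘ Sum.inr)

theorem IsBiquadratic.eval_smul {f : BiPoly m n} (hf : IsBiquadratic f) (s t : ℝ)
    (x : Fin m → ℝ) (y : Fin n → ℝ) :
    eval (Sum.elim (s • x) (t • y)) f = s ^ 2 * t ^ 2 * eval (Sum.elim x y) f := by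
  obtain ⟨a, rfl⟩ := hf
  simp only [map_sum, map_mul, eval_C, eval_X, Sum.elim_inl, Sum.elim_inr, Pi.smul_apply,
    smul_eq_mul, Finset.mul_sum]
  refine Finset.sum_congr rfl fun i _ => Finset.sum_congr rfl fun j _ =>
    Finset.sum_congr rfl fun k _ => Finset.sum_congr rfl fun l _ => ?_
  ring

theorem IsBiquadratic.eval_zero_left {f : BiPoly m n} (hf : IsBiquadratic f) (y : Fin n → ℝ) :
    eval (Sum.elim 0 y) f = 0 := by
  simpa using hf.eval_smul 0 1 0 y

theorem IsBiquadratic.eval_zero_right {f : BiPoly m n} (hf : IsBiquadratic f) (x : Fin m → ℝ) :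
    eval (Sum.elim x 0) f = 0 := by
  simpa using hf.eval_smul 1 0 x 0

theorem isHomogeneous_sum_C_mul_X {ι : Type*} [Fintype ι] (a : ι → ℝ) (f : ι → σ) :
    (∑ j, C (a j) * X (f j) : MvPolynomial σ ℝ).IsHomogeneous 1 :=
  .sum _ _ _ fun j _ => isHomogeneous_C_mul_X (a j) (f j)

theorem IsSumOfSquares.linearChange {f : BiPoly m n} (hf : IsSumOfSquares f r)
    (A : Matrix (Fin m) (Fin m) ℝ) (B : Matrix (Fin n) (Fin n) ℝ) :
    IsSumOfSquares (linearChange A B f) r :=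
  hf.aeval fun i => by cases i <;> exact isHomogeneous_sum_C_mul_X _ _

theorem isSumOfSquares_C_mul_linearChange_iff {c : ℝ} (hc : 0 < c)
    {A : Matrix (Fin m) (Fin m) ℝ} {B : Matrix (Fin n) (Fin n) ℝ} (hA : IsUnit A.det)
    (hB : IsUnit B.det) (f : BiPoly m n) :
    IsSumOfSquares (C c * linearChange A B f) r ↔ IsSumOfSquares f r := by
  refine ⟨fun h => ?_, fun h => (h.linearChange A B).C_mul hc.le⟩
  convert (h.linearChange A⁻¹ B⁻¹).C_mul (inv_nonneg.mpr hc.le) using 1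
  refine bipoly_funext fun x y => ?_
  simp only [map_mul, eval_C, eval_linearChange, Matrix.mulVec_mulVec, Matrix.mul_nonsing_inv _ hA,
    Matrix.mul_nonsing_inv _ hB, Matrix.one_mulVec]
  field_simp

/-! ### Calderón's theorem -/

theorem eval_eq_sum_dotProduct (a : Fin m → Fin m → Fin n → Fin n → ℝ) (x : Fin m → ℝ)
    (y : Fin n → ℝ) :
    eval (Sum.elim x y) (∑ i, ∑ j, ∑ k, ∑ l, C (a i j k l) *
      (X (Sum.inl i) * X (Sum.inl j) * X (Sum.inr k) * X (Sum.inr l)) : BiPoly m n) =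
    ∑ k, ∑ l, y k * y l * (x ⬝ᵥ (Matrix.of (fun i j => a i j k l) *ᵥ x)) := by
  simp only [map_sum, map_mul, eval_C, eval_X, Sum.elim_inl, Sum.elim_inr, dotProduct,
    Matrix.mulVec, Matrix.of_apply, Finset.mul_sum]
  rw [Finset.sum_congr rfl fun i _ => Finset.sum_comm, Finset.sum_comm]
  refine Finset.sum_congr rfl fun k _ => ?_
  rw [Finset.sum_congr rfl fun i _ => Finset.sum_congr rfl fun j _ => rfl]
  rw [Finset.sum_congr rfl fun i _ => Finset.sum_comm, Finset.sum_comm]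
  refine Finset.sum_congr rfl fun l _ => Finset.sum_congr rfl fun i _ =>
    Finset.sum_congr rfl fun j _ => ?_
  ring

theorem dotProduct_transpose_mulVec (M : Matrix (Fin m) (Fin m) ℝ) (x : Fin m → ℝ) :
    x ⬝ᵥ (Mᵀ *ᵥ x) = x ⬝ᵥ (M *ᵥ x) := by
  rw [Matrix.mulVec_transpose, Matrix.dotProduct_mulVec, dotProduct_comm]

theorem IsBiquadratic.exists_pencil {f : BiPoly m 2} (hf : IsBiquadratic f) :
    ∃ A B D : Matrix (Fin m) (Fin m) ℝ, A.IsHermitian ∧ B.IsHermitian ∧ D.IsHermitian ∧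
      ∀ x y, eval (Sum.elim x y) f = y 0 ^ 2 * (x ⬝ᵥ (A *ᵥ x))
        + 2 * (y 0 * y 1) * (x ⬝ᵥ (B *ᵥ x)) + y 1 ^ 2 * (x ⬝ᵥ (D *ᵥ x)) := by
  obtain ⟨a, rfl⟩ := hf
  let M : Fin 2 → Fin 2 → Matrix (Fin m) (Fin m) ℝ := fun k l => Matrix.of fun i j => a i j k l
  have hsymm : ∀ (c : ℝ) (N : Matrix (Fin m) (Fin m) ℝ), (c • (N + Nᵀ)).IsHermitian := by
    intro c N
    rw [Matrix.IsHermitian, Matrix.conjTranspose_eq_transpose_of_trivial, Matrix.transpose_smul,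
      Matrix.transpose_add, Matrix.transpose_transpose, add_comm]
  -- The factor `1 / 4` combines the `1 / 2` of symmetrization with the `2` in front of `B` in the
  -- pencil.
  refine ⟨_, _, _, hsymm (1 / 2) (M 0 0), hsymm (1 / 4) (M 0 1 + M 1 0), hsymm (1 / 2) (M 1 1),
    fun x y => ?_⟩
  rw [eval_eq_sum_dotProduct]
  simp only [M, Fin.sum_univ_two, Matrix.smul_mulVec, dotProduct_smul, Matrix.add_mulVec,
    dotProduct_add, dotProduct_transpose_mulVec, smul_eq_mul]
  ring

/-- Calderón's theorem: positive semidefinite `m × 2` biquadratic forms are sums of squares. -/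
theorem IsBiquadratic.isSOS_of_isPSD {f : BiPoly m 2} (hf : IsBiquadratic f) (hpsd : IsPSD f) :
    IsSOS f := by
  obtain ⟨A, B, D, hA, hB, hD, hval⟩ := hf.exists_pencil
  obtain ⟨K, hK, hKB⟩ := Matrix.hasGram_of_forall_nonneg hA hB hD fun s t x => by
    have h := hpsd (Sum.elim x ![s, t])
    rw [hval] at h
    simpa using h
  obtain ⟨r, v, hv⟩ := Matrix.posSemidef_iff_eq_sum_vecMulVec.mp hK
  refine ⟨r, fun i => ∑ j, (C (v i (Sum.inl j)) * (X (Sum.inl j) * X (Sum.inr 0))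
    + C (v i (Sum.inr j)) * (X (Sum.inl j) * X (Sum.inr 1))), fun i => ?_, ?_⟩
  · exact .sum _ _ _ fun j _ =>
      (((isHomogeneous_X _ _).mul (isHomogeneous_X _ _)).C_mul _).add
        (((isHomogeneous_X _ _).mul (isHomogeneous_X _ _)).C_mul _)
  refine bipoly_funext fun x y => ?_
  -- At `w = y ⊗ x` the quadratic form of the Gram matrix is `f`; its rank-one summands become the
  -- squares.
  set w : Fin m ⊕ Fin m → ℝ := Sum.elim (y 0 • x) (y 1 • x) with hw
  have h1 : w ⬝ᵥ (Matrix.fromBlocks A K Kᵀ D *ᵥ w) = ∑ i, (v i ⬝ᵥ w) ^ 2 := by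
    rw [hv, Matrix.sum_mulVec, dotProduct_sum]
    refine Finset.sum_congr rfl fun i _ => ?_
    rw [Matrix.vecMulVec_mulVec, star_trivial, dotProduct_smul, dotProduct_comm w, sq]
    rfl
  have h2 : x ⬝ᵥ (K *ᵥ x) = x ⬝ᵥ (B *ᵥ x) := by
    have := congrArg (fun N => x ⬝ᵥ (N *ᵥ x)) hKB
    simp only [Matrix.add_mulVec, dotProduct_add, dotProduct_transpose_mulVec,
      Matrix.smul_mulVec, dotProduct_smul, smul_eq_mul] at this
    linarith
  have h3 : ∀ i, v i ⬝ᵥ w = eval (Sum.elim x y) (∑ j, (C (v i (Sum.inl j)) *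
      (X (Sum.inl j) * X (Sum.inr 0)) + C (v i (Sum.inr j)) * (X (Sum.inl j) * X (Sum.inr 1))) :
        BiPoly m 2) := by
    intro i
    simp only [hw, dotProduct, Fintype.sum_sum_type, Sum.elim_inl, Sum.elim_inr, Pi.smul_apply,
      smul_eq_mul, map_sum, map_add, map_mul, eval_C, eval_X, Finset.sum_add_distrib,
      mul_comm (x _)]
  simp only [map_sum, map_pow, ← h3, ← h1, hval]
  simp only [hw, Matrix.fromBlocks_mulVec, Sum.elim_comp_inl, Sum.elim_comp_inr,
    sumElim_dotProduct_sumElim, dotProduct_add, Matrix.mulVec_smul, dotProduct_smul,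
    smul_dotProduct, smul_eq_mul, dotProduct_transpose_mulVec, h2]
  ring

/-! ### Dehomogenization -/

/-- The vector `(x, z)` with `z` in the last coordinate. -/
def snocLast (x : Fin (m - 1) → ℝ) (z : ℝ) : Fin m → ℝ :=
  fun i => if hi : i.val < m - 1 then x ⟨i.val, hi⟩ else z

theorem snocLast_zero : snocLast (0 : Fin (m - 1) → ℝ) 0 = 0 := by
  ext i
  simp [snocLast]

/-- All coordinates but the last. -/
def initIdx (i : Fin (m - 1)) : Fin m := i.castLE (Nat.sub_le m 1)

/-- The last coordinate. -/
def lastIdx (hm : 0 < m) : Fin m := ⟨m - 1, by omega⟩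

theorem snocLast_init (hm : 0 < m) (x : Fin m → ℝ) (c : ℝ) :
    snocLast (fun i => c * x (initIdx i)) (c * x (lastIdx hm)) = c • x := by
  ext i
  by_cases hi : i.val < m - 1
  · simp [snocLast, hi, initIdx]
  · have : i = lastIdx hm := Fin.ext (by simp only [lastIdx]; omega)
    subst this
    simp [snocLast, lastIdx]

theorem snocLast_zero_left (hm : 0 < m) (z : ℝ) :
    snocLast (0 : Fin (m - 1) → ℝ) z = z • Pi.single (lastIdx hm) 1 := by
  ext i
  by_cases hi : i.val < m - 1
  · have : i ≠ lastIdx hm := fun h => by simp [h, lastIdx] at hi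
    simp [snocLast, hi, this]
  · have : i = lastIdx hm := Fin.ext (by simp only [lastIdx]; omega)
    subst this
    simp [snocLast, lastIdx]

theorem eval_toTripartite (f : BiPoly m n) (x : Fin (m - 1) → ℝ) (y : Fin (n - 1) → ℝ)
    (z : Unit → ℝ) :
    eval (Sum.elim x (Sum.elim y z)) (toTripartite f) =
      eval (Sum.elim (snocLast x (z ())) (snocLast y (z ()))) f := by
  rw [toTripartite, eval_aeval_eq]
  congr 2
  ext i
  rcases i with i | i <;> simp only [Sum.elim_inl, Sum.elim_inr, snocLast] <;> split_ifs <;>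
    simp [Z]

theorem isHomogeneous_toTripartite_X (i : Fin m ⊕ Fin n) :
    (toTripartite (X i : BiPoly m n)).IsHomogeneous 1 := by
  rcases i with i | i <;> simp only [toTripartite, aeval_X, Sum.elim_inl, Sum.elim_inr] <;>
    split_ifs <;> exact isHomogeneous_X _ _

theorem toTripartite_eq_aeval (f : BiPoly m n) :
    toTripartite f = aeval (fun i => toTripartite (X i : BiPoly m n)) f := by
  simp only [toTripartite, aeval_X]

theorem IsSumOfSquares.toTripartite {f : BiPoly m n} (hf : IsSumOfSquares f r) :
    IsSumOfSquares (toTripartite f) r := by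
  rw [toTripartite_eq_aeval]
  exact hf.aeval isHomogeneous_toTripartite_X

theorem exists_single_add_single {d : σ →₀ ℕ} (hd : d.degree = 2) :
    ∃ s t, d = Finsupp.single s 1 + Finsupp.single t 1 := by
  classical
  have hcard : Multiset.card (Finsupp.toMultiset d) = 2 := by
    rw [Finsupp.card_toMultiset]
    exact hd
  obtain ⟨s, t, hst⟩ := Multiset.card_eq_two.mp hcard
  refine ⟨s, t, ?_⟩
  rw [← Finsupp.toMultiset_toFinsupp d, hst, Multiset.insert_eq_cons, ← Multiset.singleton_add,
    map_add, Multiset.toFinsupp_singleton, Multiset.toFinsupp_singleton]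

theorem exists_bilinForm {q : MvPolynomial σ ℝ} (hq : q.IsHomogeneous 2) :
    ∃ B : LinearMap.BilinForm ℝ (σ → ℝ), ∀ v, eval v q = B v v := by
  have hmon : ∀ d ∈ q.support, ∃ B : LinearMap.BilinForm ℝ (σ → ℝ),
      ∀ v, eval v (monomial d (coeff d q)) = B v v := by
    intro d hd
    have hdeg : d.degree = 2 := by
      by_contra hne
      exact (mem_support_iff.mp hd) (hq.coeff_eq_zero hne)
    obtain ⟨s, t, rfl⟩ := exists_single_add_single hdeg
    refine ⟨coeff (Finsupp.single s 1 + Finsupp.single t 1) q •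
      LinearMap.BilinForm.linMulLin (LinearMap.proj s) (LinearMap.proj t), fun v => ?_⟩
    rw [← mul_one (coeff _ q), ← C_mul_monomial, map_mul, eval_C, ← mul_one (1 : ℝ),
      ← monomial_mul, map_mul, eval_monomial, eval_monomial]
    simp
  choose! B hB using hmon
  refine ⟨∑ d ∈ q.support, B d, fun v => ?_⟩
  conv_lhs => rw [q.as_sum, map_sum, Finset.sum_congr rfl fun d hd => hB d hd v]
  simp

/-- The two vanishing hypotheses leave only terms `x_i y_j`, `x_i z`, `y_j z` and `z²` in `q`. Under
the substitution each of them acquires the factor `x_m y_n`, with a quotient bilinear in the full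
vectors. -/
theorem exists_bilinear_lift (hm : 0 < m) (hn : 0 < n) {q : TriPoly (m - 1) (n - 1)}
    (hq : q.IsHomogeneous 2) (hx : ∀ x, eval (Sum.elim x (Sum.elim 0 0)) q = 0)
    (hy : ∀ y, eval (Sum.elim 0 (Sum.elim y 0)) q = 0) :
    ∃ b : BiPoly m n, b.IsHomogeneous 2 ∧ ∀ (x : Fin m → ℝ) (y : Fin n → ℝ),
      eval (Sum.elim (fun i => y (lastIdx hn) * x (initIdx i))
        (Sum.elim (fun j => x (lastIdx hm) * y (initIdx j))
          (fun _ => x (lastIdx hm) * y (lastIdx hn)))) q =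
      x (lastIdx hm) * y (lastIdx hn) * eval (Sum.elim x y) b := by
  obtain ⟨B, hB⟩ := exists_bilinForm hq
  let u : Fin (m - 1) → BiPoly m n := fun i => X (Sum.inl (initIdx i))
  let v : Fin (n - 1) → BiPoly m n := fun j => X (Sum.inr (initIdx j))
  let z : BiPoly m n := X (Sum.inl (lastIdx hm))
  let w : BiPoly m n := X (Sum.inr (lastIdx hn))
  let sub (a : Fin (m - 1) → BiPoly m n) (b : Fin (n - 1) → BiPoly m n) (c : BiPoly m n) :=
    aeval (Sum.elim a (Sum.elim b fun _ => c)) q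
  have hsub : ∀ a b c, (∀ i, (a i).IsHomogeneous 1) → (∀ i, (b i).IsHomogeneous 1) →
      c.IsHomogeneous 1 → (sub a b c).IsHomogeneous 2 := by
    intro a b c ha hb hc
    exact hq.aeval (Sum.elim a (Sum.elim b fun _ => c)) (by
      rintro (i | i | i)
      exacts [ha i, hb i, hc])
  have hu : ∀ i, (u i).IsHomogeneous 1 := fun i => isHomogeneous_X _ _
  have hv : ∀ i, (v i).IsHomogeneous 1 := fun i => isHomogeneous_X _ _
  have hz : z.IsHomogeneous 1 := isHomogeneous_X _ _
  have hw : w.IsHomogeneous 1 := isHomogeneous_X _ _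
  have h0 : (0 : BiPoly m n).IsHomogeneous 1 := isHomogeneous_zero _ _ _
  -- The four summands isolate the `x_i y_j`, `x_i z`, `y_j z` and `z²` parts of `q`. The variable
  -- `z` of `q` becomes `y_n` beside `x_i`, `x_m` beside `y_j`, and `z²` becomes `x_m y_n`.
  refine ⟨sub u v 0 + (sub u 0 w - sub 0 0 w) + (sub 0 v z - sub 0 0 z)
    + C (eval (Sum.elim 0 (Sum.elim 0 1)) q) * (z * w), ?_, fun x y => ?_⟩
  · exact (((hsub _ _ _ hu hv h0).add ((hsub _ _ _ hu (fun _ => h0) hw).sub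
      (hsub _ _ _ (fun _ => h0) (fun _ => h0) hw))).add
      ((hsub _ _ _ (fun _ => h0) hv hz).sub (hsub _ _ _ (fun _ => h0) (fun _ => h0) hz))).add
      ((hz.mul hw).C_mul _)
  let a : Fin (m - 1) ⊕ Fin (n - 1) ⊕ Unit → ℝ := Sum.elim (fun i => x (initIdx i)) 0
  let b : Fin (m - 1) ⊕ Fin (n - 1) ⊕ Unit → ℝ :=
    Sum.elim 0 (Sum.elim (fun j => y (initIdx j)) 0)
  let e : Fin (m - 1) ⊕ Fin (n - 1) ⊕ Unit → ℝ := Sum.elim 0 (Sum.elim 0 1)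
  set X₀ := x (lastIdx hm)
  set Y₀ := y (lastIdx hn)
  have ha : B a a = 0 := by
    rw [← hB, ← hx fun i => x (initIdx i)]
    congr 2
    ext (i | i | i) <;> rfl
  have hb : B b b = 0 := by rw [← hB, ← hy fun j => y (initIdx j)]
  have hpt : Sum.elim (fun i => Y₀ * x (initIdx i)) (Sum.elim (fun j => X₀ * y (initIdx j))
      (fun _ => X₀ * Y₀)) = Y₀ • a + X₀ • b + (X₀ * Y₀) • e := by
    ext (i | i | i) <;> simp [a, b, e]
  have hev : ∀ (a' : Fin (m - 1) → BiPoly m n) (b' : Fin (n - 1) → BiPoly m n) (c' : BiPoly m n)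
      (p : Fin (m - 1) ⊕ Fin (n - 1) ⊕ Unit → ℝ),
      (fun i => eval (Sum.elim x y) (Sum.elim a' (Sum.elim b' fun _ => c') i)) = p →
      eval (Sum.elim x y) (sub a' b' c') = B p p := by
    rintro a' b' c' p rfl
    rw [← hB, eval_aeval_eq]
  have e1 := hev u v 0 (a + b) (by ext (i | i | i) <;> simp [u, v, a, b])
  have e2 := hev u 0 w (a + Y₀ • e) (by ext (i | i | i) <;> simp [u, w, a, e, Y₀])
  have e3 := hev 0 0 w (Y₀ • e) (by ext (i | i | i) <;> simp [w, e, Y₀])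
  have e4 := hev 0 v z (b + X₀ • e) (by ext (i | i | i) <;> simp [v, z, b, e, X₀])
  have e5 := hev 0 0 z (X₀ • e) (by ext (i | i | i) <;> simp [z, e, X₀])
  have e6 : eval (Sum.elim x y) (z * w) = X₀ * Y₀ := by simp [z, w, X₀, Y₀]
  have e7 : eval (Sum.elim 0 (Sum.elim 0 1)) q = B e e := hB _
  rw [hpt, hB]
  simp only [map_add (eval _), map_sub (eval _), map_mul (eval _) (C _), eval_C, e1, e2, e3, e4, e5,
    e6, e7]
  simp only [map_add, map_smul, LinearMap.add_apply, LinearMap.smul_apply, smul_eq_mul, ha, hb]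
  ring

/-- For the lifting direction, the dehomogenized form vanishes when `z = 0` and `x` or `y` is zero,
hence so does every `q i`, and each lifts. At the substituted point the form equals `(x_m y_n)² g`,
and this common factor cancels. -/
theorem isSumOfSquares_toTripartite_iff (hm : 0 < m) (hn : 0 < n) {g : BiPoly m n}
    (hg : IsBiquadratic g) : IsSumOfSquares (toTripartite g) r ↔ IsSumOfSquares g r := by
  refine ⟨?_, fun h => h.toTripartite⟩
  rintro ⟨q, hq, hsum⟩
  have hsq : ∀ v, eval v (toTripartite g) = ∑ i, eval v (q i) ^ 2 := by
    intro v
    simp [hsum]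
  have hzero : ∀ v, eval v (toTripartite g) = 0 → ∀ i, eval v (q i) = 0 := by
    intro v hv i
    rw [hsq, Finset.sum_eq_zero_iff_of_nonneg fun _ _ => sq_nonneg _] at hv
    exact pow_eq_zero_iff two_ne_zero |>.mp (hv i (Finset.mem_univ i))
  choose b hb hbq using fun i => exists_bilinear_lift hm hn (hq i)
    (fun x => hzero _ (by
      rw [eval_toTripartite, Pi.zero_apply, snocLast_zero, hg.eval_zero_right]) i)
    (fun y => hzero _ (by
      rw [eval_toTripartite, Pi.zero_apply, snocLast_zero, hg.eval_zero_left]) i)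
  refine ⟨b, hb, ?_⟩
  have hne : (X (Sum.inl (lastIdx hm)) * X (Sum.inr (lastIdx hn)) : BiPoly m n) ^ 2 ≠ 0 :=
    pow_ne_zero _ (mul_ne_zero (X_ne_zero _) (X_ne_zero _))
  refine mul_left_cancel₀ hne (bipoly_funext fun x y => ?_)
  have h := hsq (Sum.elim (fun i => y (lastIdx hn) * x (initIdx i))
    (Sum.elim (fun j => x (lastIdx hm) * y (initIdx j))
      (fun _ => x (lastIdx hm) * y (lastIdx hn))))
  rw [eval_toTripartite, snocLast_init hn, mul_comm (x _) (y _), snocLast_init hm,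
    hg.eval_smul] at h
  simp only [mul_comm (y (lastIdx hn)) (x (lastIdx hm)), hbq, mul_pow, ← Finset.mul_sum] at h
  simp only [map_mul, map_pow, map_sum, eval_X, Sum.elim_inl, Sum.elim_inr, mul_pow]
  linarith

/-! ### Tripartite forms -/

/-- Every exponent vector `d` of `p` has weight `∑ i, d (s i)` at most `a`. -/
def DegreeInLE {ι : Type*} [Fintype ι] (s : ι → σ) (p : MvPolynomial σ ℝ) (a : ℕ) : Prop :=
  ∀ d ∈ p.support, ∑ i, d (s i) ≤ a

section DegreeIn

variable {ι : Type*} [Fintype ι] {s : ι → σ} {p q : MvPolynomial σ ℝ} {a b : ℕ}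

theorem DegreeInLE.add (hp : DegreeInLE s p a) (hq : DegreeInLE s q a) :
    DegreeInLE s (p + q) a := by
  classical
  intro d hd
  rcases Finset.mem_union.mp (support_add hd) with h | h
  exacts [hp d h, hq d h]

theorem DegreeInLE.mul (hp : DegreeInLE s p a) (hq : DegreeInLE s q b) :
    DegreeInLE s (p * q) (a + b) := by
  classical
  intro d hd
  obtain ⟨d₁, h₁, d₂, h₂, rfl⟩ := Finset.mem_add.mp (support_mul p q hd)
  simpa [Finset.sum_add_distrib] using add_le_add (hp d₁ h₁) (hq d₂ h₂)

theorem degreeInLE_C (c : ℝ) : DegreeInLE s (C c : MvPolynomial σ ℝ) 0 := by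
  classical
  intro d hd
  have : d = 0 := by
    by_contra h
    exact mem_support_iff.mp hd (by rw [coeff_C, if_neg (Ne.symm h)])
  simp [this]

theorem DegreeInLE.sum {κ : Type*} {t : Finset κ} {f : κ → MvPolynomial σ ℝ}
    (hf : ∀ i ∈ t, DegreeInLE s (f i) a) : DegreeInLE s (∑ i ∈ t, f i) a :=
  Finset.sum_induction _ (DegreeInLE s · a) (fun _ _ => .add) (by simp [DegreeInLE]) hf

theorem degreeInLE_X_one (hs : s.Injective) (j : σ) :
    DegreeInLE s (X j : MvPolynomial σ ℝ) 1 := by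
  classical
  intro d hd
  rw [support_X, Finset.mem_singleton] at hd
  subst hd
  by_cases hj : ∃ i, s i = j
  · obtain ⟨i, rfl⟩ := hj
    simp [Finsupp.single_apply, hs.eq_iff]
  · push Not at hj
    simp [fun i => (hj i).symm]

theorem degreeInLE_X_zero {j : σ} (hj : ∀ i, s i ≠ j) :
    DegreeInLE s (X j : MvPolynomial σ ℝ) 0 := by
  classical
  intro d hd
  rw [support_X, Finset.mem_singleton] at hd
  subst hd
  simp [fun i => (hj i).symm]

end DegreeIn

theorem IsBiquadratic.isTripartite {g : BiPoly m n} (hg : IsBiquadratic g) :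
    IsTripartite (toTripartite g) := by
  obtain ⟨a, rfl⟩ := hg
  have hom : ∀ i, (toTripartite (X i : BiPoly m n)).IsHomogeneous 1 :=
    isHomogeneous_toTripartite_X
  have hexp : toTripartite (∑ i, ∑ j, ∑ k, ∑ l, C (a i j k l) *
      (X (Sum.inl i) * X (Sum.inl j) * X (Sum.inr k) * X (Sum.inr l)) : BiPoly m n) =
      ∑ i, ∑ j, ∑ k, ∑ l, C (a i j k l) *
        (toTripartite (X (Sum.inl i)) * toTripartite (X (Sum.inl j)) *
          toTripartite (X (Sum.inr k)) * toTripartite (X (Sum.inr l))) := by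
    simp only [toTripartite, map_sum, map_mul, algHom_C, algebraMap_eq]
  -- Here `α` and `β` bound the weights of the images of single `x`- and `y`-variables; `(1, 0)` and
  -- `(0, 1)` yield the two degree bounds.
  have hdeg : ∀ {ι : Type} [Fintype ι] (s : ι → Fin (m - 1) ⊕ Fin (n - 1) ⊕ Unit) (α β : ℕ),
      (∀ i, DegreeInLE s (toTripartite (X (Sum.inl i) : BiPoly m n)) α) →
      (∀ i, DegreeInLE s (toTripartite (X (Sum.inr i) : BiPoly m n)) β) →
      DegreeInLE s (toTripartite (∑ i, ∑ j, ∑ k, ∑ l, C (a i j k l) *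
        (X (Sum.inl i) * X (Sum.inl j) * X (Sum.inr k) * X (Sum.inr l)) : BiPoly m n))
        (0 + (α + α + β + β)) := by
    intro ι _ s α β hα hβ
    rw [hexp]
    exact .sum fun i _ => .sum fun j _ => .sum fun k _ => .sum fun l _ =>
      (degreeInLE_C _).mul ((((hα i).mul (hα j)).mul (hβ k)).mul (hβ l))
  refine ⟨?_, fun d hd => ⟨?_, ?_⟩⟩
  · rw [hexp]
    exact .sum _ _ _ fun i _ => .sum _ _ _ fun j _ => .sum _ _ _ fun k _ => .sum _ _ _ fun l _ =>
      ((((hom _).mul (hom _)).mul (hom _)).mul (hom _)).C_mul _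
  · refine hdeg (fun i => Sum.inl i) 1 0 (fun i => ?_) (fun i => ?_) d hd <;>
      simp only [toTripartite, aeval_X, Sum.elim_inl, Sum.elim_inr] <;> split_ifs
    · exact degreeInLE_X_one Sum.inl_injective _
    · exact degreeInLE_X_one Sum.inl_injective _
    · exact degreeInLE_X_zero (by simp)
    · exact degreeInLE_X_zero (by simp)
  · refine hdeg (fun i => Sum.inr (Sum.inl i)) 0 1 (fun i => ?_) (fun i => ?_) d hd <;>
      simp only [toTripartite, aeval_X, Sum.elim_inl, Sum.elim_inr] <;> split_ifs
    · exact degreeInLE_X_zero (by simp)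
    · exact degreeInLE_X_zero (by simp)
    · exact degreeInLE_X_one (Sum.inr_injective.comp Sum.inl_injective) _
    · exact degreeInLE_X_one (Sum.inr_injective.comp Sum.inl_injective) _

/-- Only pure powers of the `i`-th variable survive at a coordinate vector. This identifies the `z⁴`
coefficient with the value of the biquadratic form at the last coordinate vectors. -/
theorem eval_single_of_isHomogeneous [DecidableEq σ] {p : MvPolynomial σ ℝ} {N : ℕ}
    (hp : p.IsHomogeneous N) (i : σ) :
    eval (Pi.single i 1) p = coeff (Finsupp.single i N) p := by
  rw [eval_eq]
  refine (Finset.sum_eq_single (Finsupp.single i N) (fun d hd hne => ?_) (fun h => ?_)).trans ?_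
  · have hdeg : d.degree = N := by
      by_contra h
      exact mem_support_iff.mp hd (hp.coeff_eq_zero h)
    have hex : ∃ j ∈ d.support, j ≠ i := by
      by_contra! h
      apply hne
      have hsup : d.support ⊆ {i} := fun j hj => Finset.mem_singleton.mpr (h j hj)
      obtain ⟨c, rfl⟩ := Finsupp.support_subset_singleton'.mp hsup
      rw [Finsupp.degree_single] at hdeg
      rw [hdeg]
    obtain ⟨j, hj, hji⟩ := hex
    rw [Finset.prod_eq_zero hj, mul_zero]
    rw [Pi.single_eq_of_ne hji, zero_pow (Finsupp.mem_support_iff.mp hj)]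
  · rw [notMem_support_iff.mp h, zero_mul]
  · rw [Finset.prod_eq_one, mul_one]
    intro j hj
    have : j = i := by
      by_contra h
      exact Finsupp.mem_support_iff.mp hj (Finsupp.single_eq_of_ne h)
    simp [this]

theorem IsBiquadratic.isDegenerated (hm : 0 < m) (hn : 0 < n) {g : BiPoly m n}
    (hg : IsBiquadratic g) (hpsd : IsPSD g)
    (h0 : eval (Sum.elim (Pi.single (lastIdx hm) 1) (Pi.single (lastIdx hn) 1)) g = 0) :
    IsDegenerated (toTripartite g) := by
  refine ⟨hg.isTripartite, ?_, fun v => ?_⟩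
  · rw [← eval_single_of_isHomogeneous hg.isTripartite.1]
    have : (Pi.single (Sum.inr (Sum.inr ())) 1 : Fin (m - 1) ⊕ Fin (n - 1) ⊕ Unit → ℝ) =
        Sum.elim (0 : Fin (m - 1) → ℝ) (Sum.elim (0 : Fin (n - 1) → ℝ) 1) := by
      ext (i | i | i) <;> simp
    rw [this, eval_toTripartite, Pi.one_apply, snocLast_zero_left hm, snocLast_zero_left hn,
      one_smul, one_smul, h0]
  · have : v = Sum.elim (v ∘ Sum.inl) (Sum.elim (v ∘ Sum.inr ∘ Sum.inl)
        (v ∘ Sum.inr ∘ Sum.inr)) := by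
      ext (i | i | i) <;> rfl
    rw [this, eval_toTripartite]
    exact hpsd _

/-! ### Moving a minimizer to the last coordinates -/

theorem exists_orthogonal_mulVec_single (i : Fin m) {u : EuclideanSpace ℝ (Fin m)}
    (hu : ‖u‖ = 1) :
    ∃ A : Matrix (Fin m) (Fin m) ℝ, Aᵀ * A = 1 ∧ A *ᵥ Pi.single i 1 = u.ofLp := by
  have hort : Orthonormal ℝ (({i} : Set (Fin m)).domRestrict fun _ => u) := by
    rw [orthonormal_iff_ite]
    rintro ⟨a, rfl⟩ ⟨b, hb⟩
    simp only [Set.mem_singleton_iff] at hb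
    subst hb
    simp [hu]
  obtain ⟨b, hb⟩ := hort.exists_orthonormalBasis_extension_of_card_eq (by simp)
  refine ⟨Matrix.of fun p q => b q p, ?_, ?_⟩
  · ext p q
    have h := orthonormal_iff_ite.mp b.orthonormal p q
    rw [Matrix.one_apply, ← h]
    simp [Matrix.mul_apply, PiLp.inner_apply, mul_comm]
  · ext p
    simp [hb i rfl]

theorem sq_apply_le_dotProduct (x : Fin m → ℝ) (i : Fin m) : x i ^ 2 ≤ x ⬝ᵥ x := by
  simp only [dotProduct, ← sq]
  exact Finset.single_le_sum (f := fun i => x i ^ 2) (fun j _ => sq_nonneg _) (Finset.mem_univ i)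

theorem dotProduct_mulVec_self_of_orthogonal {A : Matrix (Fin m) (Fin m) ℝ} (hA : Aᵀ * A = 1)
    (x : Fin m → ℝ) : (A *ᵥ x) ⬝ᵥ (A *ᵥ x) = x ⬝ᵥ x := by
  rw [Matrix.dotProduct_mulVec, Matrix.vecMul_mulVec, hA, Matrix.vecMul_one]

theorem isUnit_det_of_orthogonal {A : Matrix (Fin m) (Fin m) ℝ} (hA : Aᵀ * A = 1) :
    IsUnit A.det :=
  Matrix.isUnit_det_of_left_inverse hA

/-- A minimizer on the compact product of spheres exists, and scaling `x` and `y` separately extends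
the bound to all vectors. -/
theorem exists_sphere_le (hm : 0 < m) (hn : 0 < n) {f : BiPoly m n} (hf : IsBiquadratic f) :
    ∃ (u : EuclideanSpace ℝ (Fin m)) (v : EuclideanSpace ℝ (Fin n)), ‖u‖ = 1 ∧ ‖v‖ = 1 ∧
      ∀ x y, eval (Sum.elim u.ofLp v.ofLp) f * (x ⬝ᵥ x) * (y ⬝ᵥ y) ≤ eval (Sum.elim x y) f := by
  have : Nonempty (Fin m) := ⟨⟨0, hm⟩⟩
  have : Nonempty (Fin n) := ⟨⟨0, hn⟩⟩
  let F : EuclideanSpace ℝ (Fin m) × EuclideanSpace ℝ (Fin n) → ℝ :=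
    fun p => eval (Sum.elim p.1.ofLp p.2.ofLp) f
  have hF : Continuous F := by
    refine (MvPolynomial.continuous_eval f).comp (continuous_pi fun i => ?_)
    rcases i with i | i <;> simp only [Sum.elim_inl, Sum.elim_inr] <;> fun_prop
  obtain ⟨p, hp, hmin⟩ := ((isCompact_sphere (0 : EuclideanSpace ℝ (Fin m)) 1).prod
    (isCompact_sphere (0 : EuclideanSpace ℝ (Fin n)) 1)).exists_isMinOn
    ((NormedSpace.sphere_nonempty.mpr zero_le_one).prod
      (NormedSpace.sphere_nonempty.mpr zero_le_one)) hF.continuousOn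
  refine ⟨p.1, p.2, by simpa using hp.1, by simpa using hp.2, fun x y => ?_⟩
  by_cases hx : x = 0
  · simp [hx, hf.eval_zero_left]
  by_cases hy : y = 0
  · simp [hy, hf.eval_zero_right]
  have hnorm : ∀ {N : ℕ} (z : Fin N → ℝ), z ⬝ᵥ z = ‖WithLp.toLp 2 z‖ ^ 2 := fun z => by
    rw [EuclideanSpace.norm_sq_eq]
    simp [dotProduct, sq]
  have hx' : ‖WithLp.toLp 2 x‖ ≠ 0 := by simpa using hx
  have hy' : ‖WithLp.toLp 2 y‖ ≠ 0 := by simpa using hy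
  set a := ‖WithLp.toLp 2 x‖
  set b := ‖WithLp.toLp 2 y‖
  have hle : F p ≤ F (a⁻¹ • WithLp.toLp 2 x, b⁻¹ • WithLp.toLp 2 y) := by
    refine hmin ⟨?_, ?_⟩
    · simp [norm_smul, a, hx]
    · simp [norm_smul, b, hy]
  have hval : F (a⁻¹ • WithLp.toLp 2 x, b⁻¹ • WithLp.toLp 2 y) =
      a⁻¹ ^ 2 * b⁻¹ ^ 2 * eval (Sum.elim x y) f := hf.eval_smul _ _ x y
  rw [hval] at hle
  rw [hnorm, hnorm]
  calc F p * a ^ 2 * b ^ 2 ≤ (a⁻¹ ^ 2 * b⁻¹ ^ 2 * eval (Sum.elim x y) f) * a ^ 2 * b ^ 2 := by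
        gcongr
    _ = _ := by field_simp

/-- Orthogonal matrices carrying the last coordinate vectors to the minimizer preserve `|x|²` and
`|y|²`. Since `μ ≥ 0`, the spherical bound may be weakened to the single term `x_m² y_n²`, which is
a square and agrees with the form at the minimizer. -/
theorem exists_linearChange_le (hm : 0 < m) (hn : 0 < n) {f : BiPoly m n} (hf : IsBiquadratic f)
    (hpsd : IsPSD f) :
    ∃ (A : Matrix (Fin m) (Fin m) ℝ) (B : Matrix (Fin n) (Fin n) ℝ) (μ : ℝ),
      IsUnit A.det ∧ IsUnit B.det ∧ 0 ≤ μ ∧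
      eval (Sum.elim (Pi.single (lastIdx hm) 1) (Pi.single (lastIdx hn) 1))
        (linearChange A B f) = μ ∧
      ∀ x y, μ * x (lastIdx hm) ^ 2 * y (lastIdx hn) ^ 2 ≤
        eval (Sum.elim x y) (linearChange A B f) := by
  obtain ⟨u, v, hu, hv, hle⟩ := exists_sphere_le hm hn hf
  obtain ⟨A, hA, hAu⟩ := exists_orthogonal_mulVec_single (lastIdx hm) hu
  obtain ⟨B, hB, hBv⟩ := exists_orthogonal_mulVec_single (lastIdx hn) hv
  refine ⟨A, B, eval (Sum.elim u.ofLp v.ofLp) f, isUnit_det_of_orthogonal hA,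
    isUnit_det_of_orthogonal hB, hpsd _, by rw [eval_linearChange, hAu, hBv], fun x y => ?_⟩
  have h0 := hpsd (Sum.elim u.ofLp v.ofLp)
  have h := hle (A *ᵥ x) (B *ᵥ y)
  rw [dotProduct_mulVec_self_of_orthogonal hA, dotProduct_mulVec_self_of_orthogonal hB] at h
  rw [eval_linearChange]
  refine le_trans ?_ h
  have hx := sq_apply_le_dotProduct x (lastIdx hm)
  have hy := sq_apply_le_dotProduct y (lastIdx hn)
  have hxx : 0 ≤ x ⬝ᵥ x := (sq_nonneg _).trans hx
  gcongr

/-! ### Reduction to degenerated tripartite forms -/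

theorem sosRank_toTripartite_linearChange (hm : 0 < m) (hn : 0 < n) {f : BiPoly m n}
    (hf : IsBiquadratic f) {c : ℝ} (hc : 0 < c) {A : Matrix (Fin m) (Fin m) ℝ}
    {B : Matrix (Fin n) (Fin n) ℝ} (hA : IsUnit A.det) (hB : IsUnit B.det) :
    sosRank f = sosRank (toTripartite (C c * linearChange A B f)) :=
  sosRank_congr fun r => by
    rw [isSumOfSquares_toTripartite_iff hm hn ((hf.linearChange A B).C_mul c),
      isSumOfSquares_C_mul_linearChange_iff hc hA hB]

theorem exists_isDegenerated_correspondsTo (hm : 0 < m) {f : BiPoly m 2} (hf : IsBiquadratic f)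
    {A : Matrix (Fin m) (Fin m) ℝ} {B : Matrix (Fin 2) (Fin 2) ℝ} {μ : ℝ}
    (hA : IsUnit A.det) (hB : IsUnit B.det) (hμ : 0 < μ)
    (hval : eval (Sum.elim (Pi.single (lastIdx hm) 1) (Pi.single (lastIdx two_pos) 1))
      (linearChange A B f) = μ)
    (hle : ∀ x y, μ * x (lastIdx hm) ^ 2 * y (lastIdx two_pos) ^ 2 ≤
      eval (Sum.elim x y) (linearChange A B f)) :
    ∃ h : TriPoly (m - 1) 1, IsDegenerated h ∧ IsSOS h ∧ CorrespondsTo f (h + Z ^ 4) ∧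
      sosRank f = sosRank (h + Z ^ 4) ∧ sosRank f ≤ sosRank h + 1 := by
  have hμ' := inv_pos.mpr hμ
  set s : BiPoly m 2 := X (Sum.inl (lastIdx hm)) * X (Sum.inl (lastIdx hm)) *
    X (Sum.inr (lastIdx two_pos)) * X (Sum.inr (lastIdx two_pos)) with hs
  set g : BiPoly m 2 := C μ⁻¹ * linearChange A B f - s with hgdef
  have hg : IsBiquadratic g :=
    ((hf.linearChange A B).C_mul _).sub (isBiquadratic_X_mul _ _ _ _)
  have hgval : ∀ x y, eval (Sum.elim x y) g = μ⁻¹ * eval (Sum.elim x y) (linearChange A B f)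
      - x (lastIdx hm) ^ 2 * y (lastIdx two_pos) ^ 2 := by
    intro x y
    simp only [hgdef, hs, map_sub, map_mul, eval_C, eval_X, Sum.elim_inl, Sum.elim_inr]
    ring
  have hgpsd : IsPSD g := by
    intro v
    rw [← Sum.elim_comp_inl_inr v, hgval, sub_nonneg, ← div_eq_inv_mul, le_div_iff₀ hμ]
    refine le_trans (le_of_eq ?_) (hle _ _)
    ring
  have hg0 : eval (Sum.elim (Pi.single (lastIdx hm) 1) (Pi.single (lastIdx two_pos) 1)) g = 0 := by
    rw [hgval, hval]
    simp [hμ.ne']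
  obtain ⟨r, hr⟩ := hg.isSOS_of_isPSD hgpsd
  have hsZ : toTripartite s = Z ^ 4 := by
    simp [hs, toTripartite, lastIdx]
    ring
  have hp : toTripartite g + Z ^ 4 = toTripartite (C μ⁻¹ * linearChange A B f) := by
    rw [← hsZ, hgdef, toTripartite, toTripartite, toTripartite, ← map_add, sub_add_cancel]
  have hrank := sosRank_toTripartite_linearChange hm two_pos hf hμ' hA hB
  refine ⟨toTripartite g, hg.isDegenerated hm two_pos hgpsd hg0, ⟨r, hr.toTripartite⟩,
    ⟨μ⁻¹, A, B, hμ', hA, hB, hp⟩, hp ▸ hrank, ?_⟩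
  rw [hrank, ← hp, show (Z : TriPoly (m - 1) 1) ^ 4 = (Z ^ 2) ^ 2 by ring]
  exact sosRank_add_sq_le _ (isHomogeneous_X_pow _ _)

theorem IsBiquadratic.isPSD_of_isPD {f : BiPoly m n} (hf : IsBiquadratic f) (h : IsPD f) :
    IsPSD f := by
  intro v
  rw [← Sum.elim_comp_inl_inr v]
  by_cases hx : v ∘ Sum.inl = 0
  · rw [hx, hf.eval_zero_left]
  by_cases hy : v ∘ Sum.inr = 0
  · rw [hy, hf.eval_zero_right]
  exact (h _ _ hx hy).le

end Biquad

theorem theorem2p3 (m : ℕ) (hm : 2 ≤ m) :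
    (∀ f : Biquad.BiPoly m 2, Biquad.IsBiquadratic f → Biquad.IsPD f →
      ∃ h : Biquad.TriPoly (m - 1) 1,
        Biquad.IsDegenerated h ∧ Biquad.IsSOS h ∧
        Biquad.CorrespondsTo f (h + Biquad.Z ^ 4) ∧
        Biquad.sosRank f = Biquad.sosRank (h + Biquad.Z ^ 4) ∧
        Biquad.sosRank f ≤ Biquad.sosRank h + 1) ∧
    (∀ r : ℕ,
      (∀ h : Biquad.TriPoly (m - 1) 1, Biquad.IsDegenerated h → Biquad.sosRank h ≤ r) →
      ∀ f : Biquad.BiPoly m 2, Biquad.IsBiquadratic f → Biquad.IsPSD f →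
        Biquad.sosRank f ≤ r + 1) := by
  have hm0 : 0 < m := by omega
  refine ⟨fun f hf hpd => ?_, fun r hr f hf hpsd => ?_⟩
  · obtain ⟨A, B, μ, hA, hB, -, hval, hle⟩ :=
      Biquad.exists_linearChange_le hm0 two_pos hf (hf.isPSD_of_isPD hpd)
    -- The value `μ` is that of `f` at the images of coordinate vectors under invertible matrices,
    -- and these images are nonzero.
    have hμ : 0 < μ := by
      rw [← hval, Biquad.eval_linearChange]
      refine hpd _ _ (fun h0 => ?_) (fun h0 => ?_)
      · have := Matrix.mulVec_injective_of_isUnit ((Matrix.isUnit_iff_isUnit_det A).mpr hA)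
          (h0.trans (Matrix.mulVec_zero A).symm)
        simp at this
      · have := Matrix.mulVec_injective_of_isUnit ((Matrix.isUnit_iff_isUnit_det B).mpr hB)
          (h0.trans (Matrix.mulVec_zero B).symm)
        simp at this
    exact Biquad.exists_isDegenerated_correspondsTo hm0 hf hA hB hμ hval hle
  · obtain ⟨A, B, μ, hA, hB, hμ, hval, hle⟩ :=
      Biquad.exists_linearChange_le hm0 two_pos hf hpsd
    -- If the minimum is zero, the transformed form is already degenerated and no extra square is
    -- needed.
    rcases hμ.eq_or_lt with rfl | hμ
    · rw [Biquad.sosRank_toTripartite_linearChange hm0 two_pos hf one_pos hA hB, map_one, one_mul]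
      refine (hr _ ((hf.linearChange A B).isDegenerated hm0 two_pos (fun v => ?_) hval)).trans
        le_self_add
      rw [← Sum.elim_comp_inl_inr v]
      simpa using hle (v ∘ Sum.inl) (v ∘ Sum.inr)
    · obtain ⟨h, hdeg, -, -, -, hrank⟩ :=
        Biquad.exists_isDegenerated_correspondsTo hm0 hf hA hB hμ hval hle
      exact hrank.trans (add_le_add_left (hr h hdeg) 1)
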